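/- **Model.** A line network consists of nodes $v_0,\dots,v_L$ ($L\ge 1$) and links $i=1,\dots,L$, where link $i$ goes from $v_{i-1}$ to $v_i$. The source $v_0$ holds $k$ message vectors over $\mathbb F_2$, and the sink $v_L$ requires all of them. At each time instant $1,2,3,\dots$ one packet is transmitted over every link (deterministic regular transmissions). A packet transmitted over link $i$ is received, without delay, with probability $p_i\in(0,1]$ and is otherwise lost, independently over all links and time instants (Bernoulli losses). In a dense code the source transmits at each time a random $\mathbb F_2$-linear combination of the message vectors, and each interior node transmits a random $\mathbb F_2$-linear combination of the packets that it has received at earlier times; all coefficients (labelled by transmitting node, time of transmission, and message vector or time of reception of the packet combined) are independent and uniform on $\mathbb F_2$, and are independent of the losses. The global encoding vector of a packet is the vector in $\mathbb F_2^k$ of its coefficients with respect to the message vectors. The coding delay is the first time at which the sink has received $k$ packets with linearly independent global encoding vectors. The average coding delay of a code (i.e. of a realization of all the coefficients) is the expectation of its coding delay over the losses only; it is a random variable, a function of the random code. **Theorem.** Let $L=L(k)\ge 1$, $p_i=p_i(k)\in(0,1]$ for $1\le i\le L$, and $\epsilon=\epsilon(k)\in(0,1)$ be arbitrary (they may, but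 need not, depend on $k$), and put $p=\min_{1\le i\le L}p_i$. Write $\log$ for the logarithm to base $2$. Let $w=w(k)$ satisfy \[ w\sim\left(\frac{kL}{\log(kL/\epsilon)}\right)^{1/2}\qquad(k\to\infty), \] and suppose that \[ w\log\frac{wL}{\epsilon}=o(k)\qquad(k\to\infty). \] Then there is a sequence $\delta_k\to0$ such that, for all sufficiently large $k$, the average coding delay of a random dense code for $k$ message vectors over the line network of $L$ links with deterministic regular transmissions and Bernoulli losses with parameters $p_1,\dots,p_L$ is larger than \[ \frac1p\left(k+(1+\delta_k)\left(\frac{kL}{w}+w\log\frac{wL}{\epsilon}\right)\right) \] with probability at most $\epsilon$ (the probability being taken over the code). -/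

import Mathlib

open MeasureTheory ProbabilityTheory Filter Asymptotics Topology
open scoped ENNReal

namespace LineNetwork

/-- Labels of the random coefficients of a dense code for a message of `k` vectors over a line
network with `L` links (link `i : Fin L` goes from node `i` to node `i + 1`).
`Sum.inl (t, a)` is the coefficient that the source gives to message vector `a` in the packet it
transmits in time slot `t`. `Sum.inr (i, t, m)` is the coefficient that node `i` gives, in the
packet it transmits in slot `t`, to the packet that it received in slot `m` (this is used only for
interior nodes `0 < i`, for `m < t`, and if there was a successful reception in slot `m`). -/
abbrev CoeffIndex (k L : ℕ) : Type := (ℕ × Fin k) ⊕ (Fin L × ℕ × ℕ)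

/-- A realization of a dense code: all the local coefficients over the field with two elements. -/
abbrev Code (k L : ℕ) : Type := CoeffIndex k L → ZMod 2

/-- A realization of the traffic: `s (i, t)` tells whether the packet transmitted over link `i` in
slot `t` is successful. There is one transmission per link and time slot. -/
abbrev Traffic (L : ℕ) : Type := Fin L × ℕ → Bool

/-- Global encoding vector of the packet transmitted by node `i` (over link `i`) in slot `t`. The
source combines the message vectors; an interior node combines its previously received packets. -/
def packet {k L : ℕ} (c : Code k L) (s : Traffic L) :
    (i : ℕ) → i < L → ℕ → (Fin k → ZMod 2)
  | 0, _, t => fun a => c (Sum.inl (t, a))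
  | i + 1, hi, t => ∑ m ∈ Finset.range t,
      if s (⟨i, Nat.lt_of_succ_lt hi⟩, m) = true then
        c (Sum.inr (⟨i + 1, hi⟩, t, m)) • packet c s i (Nat.lt_of_succ_lt hi) m
      else 0

/-- Global encoding vectors of the packets received by the sink (node `L`), over the last link,
in the first `n` time slots. -/
def sinkReceived {k L : ℕ} (c : Code k L) (s : Traffic L) (n : ℕ) : Set (Fin k → ZMod 2) :=
  {v | ∃ (i : ℕ) (hi : i < L) (m : ℕ),
    i + 1 = L ∧ m < n ∧ s (⟨i, hi⟩, m) = true ∧ v = packet c s i hi m}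

/-- After `n` time slots the sink can recover all the `k` message vectors: it has received `k`
packets with linearly independent global encoding vectors. -/
def Decodable {k L : ℕ} (c : Code k L) (s : Traffic L) (n : ℕ) : Prop :=
  ∃ v : Fin k → (Fin k → ZMod 2), (∀ a, v a ∈ sinkReceived c s n) ∧ LinearIndependent (ZMod 2) v

/-- The coding delay of a given code over a given traffic: the least number of time slots after
which the sink can recover the message (`⊤` if this never happens). -/
noncomputable def codingDelay {k L : ℕ} (c : Code k L) (s : Traffic L) : ℝ≥0∞ :=
  ⨅ (n : ℕ) (_ : Decodable c s n), (n : ℝ≥0∞)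

/-- Law of a randomly chosen dense code: the coefficients are independent and uniform. -/
noncomputable def codeLaw (k L : ℕ) : Measure (Code k L) :=
  Measure.infinitePi fun _ => uniformOn (Set.univ : Set (ZMod 2))

/-- Law of the traffic: successes are independent over all the links and time slots, with
probability `p i` over link `i`. -/
noncomputable def trafficLaw {L : ℕ} (p : Fin L → unitInterval) : Measure (Traffic L) :=
  Measure.infinitePi fun x => bernoulliMeasure true false (p x.1)

/-- The average coding delay of a code: its coding delay averaged over the traffic (but not over
the code), a random variable on the space of codes. -/
noncomputable def averageCodingDelay {k L : ℕ} (p : Fin L → unitInterval) (c : Code k L) : ℝ≥0∞ :=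
  ∫⁻ s, codingDelay c s ∂(trafficLaw p)

end LineNetwork

/-! Fix `x ≠ 0` in `F_2^k` and call the reception of a packet not orthogonal to `x` a hit. If the
sink cannot decode, some `x ≠ 0` has produced no hit there (`exists_not_active_of_not_decodable`).
For a fixed traffic, follow the front, the last node that `x` has reached. Given the past, the front
node sends a uniform bit (`codeLaw_isFront_bit`), because a coefficient used for the first time in
this slot enters the bit additively. Hence each success on its outgoing link moves the front with
probability 1/2. The resulting chain `frontWeight`, with a union bound over fewer than `2^k`
functionals, bounds the failure probability over the code.

This bound still has to be averaged over the losses. Its first moment decays only like `(1 -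
p/2)^n`, which for `p < 1` is slower than the `2^(-pn)` that is needed. A fractional moment with
small exponent `α = t / ln 2` comes close to the right rate: `(a + b)^α ≤ a^α + b^α` keeps the
recursion linear, and weighting position `i` by `k^(-i)` reduces it to one factor `1 - pκ` per slot,
with `κ ≈ t`, at the price of a prefactor `k^L` (`sum_frontMoment_le`).

For a bound that holds for most codes, the slots are split according to whether the union bound
exceeds a level `e` (`codeLaw_lt_averageCodingDelay_le_of_tsum`). The exceptional slots depend on
the traffic only and give the deterministic part `S` of the delay; the others contribute at most `e
* S` on average over the code, and Markov's inequality applies.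

With `Λ = log (kL/ε)` and `t = √(LΛ/k)` the overhead is at most `(7/5) k t`. The two terms allowed
by the theorem are about `k t` and at least almost `k t / 2`, so even `δ = 0` suffices. -/

namespace LineNetwork

/-! ### Resampling one coordinate of a product measure. -/

section Resampling

variable {ι : Type*} [DecidableEq ι] {X : ι → Type*} [∀ i, MeasurableSpace (X i)]
  (μ : ∀ i, Measure (X i)) [∀ i, IsProbabilityMeasure (μ i)]

theorem measurable_update_prod (j : ι) :
    Measurable fun q : (∀ i, X i) × X j => Function.update q.1 j q.2 := by
  refine measurable_pi_lambda _ fun i => ?_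
  by_cases h : i = j
  · subst h
    simpa using measurable_snd
  · simp only [ne_eq, h, not_false_eq_true, Function.update_of_ne]
    exact (measurable_pi_apply i).comp measurable_fst

/-- Resampling one coordinate does not change a product measure. -/
theorem map_update_infinitePi (j : ι) :
    ((Measure.infinitePi μ).prod (μ j)).map
      (fun q : (∀ i, X i) × X j => Function.update q.1 j q.2) = Measure.infinitePi μ := by
  refine Measure.eq_infinitePi μ fun s t ht => ?_
  rw [Measure.map_apply (measurable_update_prod j)
    (MeasurableSet.pi s.countable_toSet fun i _ => ht i)]
  by_cases hj : j ∈ s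
  · have : (fun q : (∀ i, X i) × X j => Function.update q.1 j q.2) ⁻¹' (Set.pi s t) =
        (Set.pi (s.erase j : Finset ι) t) ×ˢ t j := by
      ext ⟨q, b⟩
      simp only [Set.mem_preimage, Set.mem_pi, Finset.mem_coe, Set.mem_prod, Finset.mem_erase]
      constructor
      · intro h
        refine ⟨fun i hi => ?_, ?_⟩
        · simpa [Function.update_of_ne hi.1] using h i hi.2
        · simpa using h j hj
      · rintro ⟨h1, h2⟩ i hi
        by_cases hij : i = j
        · subst hij
          simpa using h2
        · simpa [Function.update_of_ne hij] using h1 i ⟨hij, hi⟩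
    rw [this, Measure.prod_prod, Measure.infinitePi_pi μ fun i _ => ht i,
      Finset.prod_erase_mul s (fun i => μ i (t i)) hj]
  · have : (fun q : (∀ i, X i) × X j => Function.update q.1 j q.2) ⁻¹' (Set.pi s t) =
        (Set.pi (s : Set ι) t) ×ˢ Set.univ := by
      ext ⟨q, b⟩
      simp only [Set.mem_preimage, Set.mem_pi, Finset.mem_coe, Set.mem_prod, Set.mem_univ,
        and_true]
      refine forall₂_congr fun i hi => ?_
      rw [Function.update_of_ne (ne_of_mem_of_not_mem hi hj)]
    rw [this, Measure.prod_prod, Measure.infinitePi_pi μ fun i _ => ht i, measure_univ, mul_one]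

theorem lintegral_infinitePi_update (j : ι) {f : (∀ i, X i) → ℝ≥0∞} (hf : Measurable f) :
    ∫⁻ x, f x ∂(Measure.infinitePi μ) =
      ∫⁻ x, ∫⁻ b, f (Function.update x j b) ∂(μ j) ∂(Measure.infinitePi μ) := by
  conv_lhs => rw [← map_update_infinitePi μ j]
  rw [lintegral_map hf (measurable_update_prod j)]
  exact lintegral_prod _ (hf.comp (measurable_update_prod j)).aemeasurable

end Resampling

/-! ### Uniform coefficients and fresh bits. -/

variable {k L : ℕ}

instance : IsProbabilityMeasure (uniformOn (Set.univ : Set (ZMod 2))) :=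
  isProbabilityMeasure_uniformOn Set.finite_univ Set.univ_nonempty

instance : IsProbabilityMeasure (codeLaw k L) := by
  unfold codeLaw; infer_instance

instance (p : Fin L → unitInterval) : IsProbabilityMeasure (trafficLaw p) := by
  unfold trafficLaw; infer_instance

theorem uniformOn_zmod_two_singleton (a : ZMod 2) :
    uniformOn (Set.univ : Set (ZMod 2)) {a} = 2⁻¹ := by
  rw [uniformOn_univ]
  simp

/-- An event that does not involve the coefficient `J` is independent of a bit to which this
coefficient is added. -/
theorem codeLaw_inter_bit {A : Set (Code k L)} (hA : MeasurableSet A) {b : Code k L → ZMod 2}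
    (hb : Measurable b) (J : CoeffIndex k L)
    (hAJ : ∀ c v, Function.update c J v ∈ A ↔ c ∈ A)
    (hbJ : ∀ c ∈ A, ∀ v, b (Function.update c J v) = b (Function.update c J 0) + v)
    (β : ZMod 2) :
    codeLaw k L (A ∩ {c | b c = β}) = 2⁻¹ * codeLaw k L A := by
  have hm : MeasurableSet (A ∩ {c | b c = β}) := hA.inter (hb (measurableSet_singleton β))
  rw [← lintegral_indicator_one hm, ← lintegral_indicator_one hA, codeLaw,
    lintegral_infinitePi_update _ J (measurable_one.indicator hm),
    ← lintegral_const_mul _ (measurable_one.indicator hA)]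
  refine lintegral_congr fun c => ?_
  by_cases hc : c ∈ A
  -- With the other coefficients fixed, exactly one value of coefficient `J` makes the bit equal to
  -- `β`.
  · have : ∀ v, (A ∩ {c | b c = β}).indicator (1 : Code k L → ℝ≥0∞) (Function.update c J v) =
        ({β - b (Function.update c J 0)} : Set (ZMod 2)).indicator 1 v := by
      intro v
      have h1 : Function.update c J v ∈ A ∩ {c | b c = β} ↔
          v ∈ ({β - b (Function.update c J 0)} : Set (ZMod 2)) := by
        simp only [Set.mem_inter_iff, hAJ, hc, true_and, Set.mem_ofPred_eq, hbJ c hc v,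
          Set.mem_singleton_iff, eq_sub_iff_add_eq, add_comm v]
      simp only [Set.indicator, h1, Pi.one_apply]
    simp only [this]
    rw [lintegral_indicator_one (measurableSet_singleton _), uniformOn_zmod_two_singleton]
    simp [hc]
  · have : ∀ v, (A ∩ {c | b c = β}).indicator (1 : Code k L → ℝ≥0∞) (Function.update c J v) = 0 :=
      fun v => Set.indicator_of_notMem (fun h => hc ((hAJ c v).1 h.1)) _
    simp [this, hc]

/-! ### Propagation of one functional along the line. -/

/-- Success over the link out of node `i`, with node indices of type `ℕ`. -/
def success (s : Traffic L) (i t : ℕ) : Bool := if h : i < L then s (⟨i, h⟩, t) else false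

/-- The inner product with `x` of the global encoding vector sent by node `i` in slot `t`. -/
def bit (x : Fin k → ZMod 2) (c : Code k L) (s : Traffic L) (i t : ℕ) : ZMod 2 :=
  if h : i < L then x ⬝ᵥ packet c s i h t else 0

/-- The packet sent by node `i` in slot `t` is received and not orthogonal to `x`. -/
def Hit (x : Fin k → ZMod 2) (c : Code k L) (s : Traffic L) (i t : ℕ) : Prop :=
  success s i t = true ∧ bit x c s i t = 1

/-- Before slot `n`, node `i` has received a packet that is not orthogonal to `x`. -/
def Active (x : Fin k → ZMod 2) (c : Code k L) (s : Traffic L) : ℕ → ℕ → Prop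
  | 0, _ => True
  | i + 1, n => ∃ m < n, Hit x c s i m

/-- Node `i` is the last active node before slot `n`. -/
def IsFront (x : Fin k → ZMod 2) (c : Code k L) (s : Traffic L) (i n : ℕ) : Prop :=
  Active x c s i n ∧ ¬ Active x c s (i + 1) n

theorem bit_zero (hL : 0 < L) (x : Fin k → ZMod 2) (c : Code k L) (s : Traffic L) (t : ℕ) :
    bit x c s 0 t = ∑ a, x a * c (Sum.inl (t, a)) := by
  simp [bit, hL, packet, dotProduct]

theorem bit_succ {i : ℕ} (h : i + 1 < L) (x : Fin k → ZMod 2) (c : Code k L) (s : Traffic L)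
    (t : ℕ) :
    bit x c s (i + 1) t = ∑ m ∈ Finset.range t,
      if success s i m = true then c (Sum.inr (⟨i + 1, h⟩, t, m)) * bit x c s i m else 0 := by
  have h' : i < L := Nat.lt_of_succ_lt h
  simp only [bit, h, h', dif_pos, packet, success, dotProduct_sum]
  refine Finset.sum_congr rfl fun m _ => ?_
  split_ifs
  · rw [dotProduct_smul, smul_eq_mul]
  · simp

/-- The slot in which a coefficient is used. -/
def slot : CoeffIndex k L → ℕ := Sum.elim (fun y => y.1) (fun y => y.2.1)

/-- Causality: this is what makes a coefficient of slot `n` independent of everything decided before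
slot `n`. -/
theorem bit_congr (x : Fin k → ZMod 2) {c c' : Code k L} (s : Traffic L) {t : ℕ}
    (h : ∀ J, slot J ≤ t → c J = c' J) (i : ℕ) : bit x c s i t = bit x c' s i t := by
  induction i generalizing t with
  | zero =>
    by_cases hL : 0 < L
    · rw [bit_zero hL, bit_zero hL]
      refine Finset.sum_congr rfl fun a _ => ?_
      rw [h _ (by simp [slot])]
    · simp [bit, hL]
  | succ i ih =>
    by_cases hL : i + 1 < L
    · rw [bit_succ hL, bit_succ hL]
      refine Finset.sum_congr rfl fun m hm => ?_
      rw [h _ (by simp [slot]), ih fun J hJ => h J (hJ.trans (Finset.mem_range.1 hm).le)]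
    · simp [bit, hL]

theorem bit_update (x : Fin k → ZMod 2) (c : Code k L) (s : Traffic L) {t : ℕ}
    {J : CoeffIndex k L} (hJ : t < slot J) (v : ZMod 2) (i : ℕ) :
    bit x (Function.update c J v) s i t = bit x c s i t := by
  refine bit_congr x s (fun J' h => ?_) i
  have hne : J' ≠ J := fun h' => absurd (h' ▸ h) hJ.not_ge
  simp [hne]

theorem hit_update (x : Fin k → ZMod 2) (c : Code k L) (s : Traffic L) {t : ℕ}
    {J : CoeffIndex k L} (hJ : t < slot J) (v : ZMod 2) (i : ℕ) :
    Hit x (Function.update c J v) s i t ↔ Hit x c s i t := by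
  rw [Hit, Hit, bit_update x c s hJ]

theorem active_update (x : Fin k → ZMod 2) (c : Code k L) (s : Traffic L) {n : ℕ}
    {J : CoeffIndex k L} (hJ : n ≤ slot J) (v : ZMod 2) (i : ℕ) :
    Active x (Function.update c J v) s i n ↔ Active x c s i n := by
  cases i with
  | zero => simp [Active]
  | succ i =>
    simp only [Active]
    exact exists_congr fun m => and_congr_right fun hm => hit_update x c s (hm.trans_le hJ) v i

theorem isFront_update (x : Fin k → ZMod 2) (c : Code k L) (s : Traffic L) {n : ℕ}
    {J : CoeffIndex k L} (hJ : n ≤ slot J) (v : ZMod 2) (i : ℕ) :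
    IsFront x (Function.update c J v) s i n ↔ IsFront x c s i n := by
  rw [IsFront, IsFront, active_update x c s hJ, active_update x c s hJ]

theorem zmod_two_eq_one_of_ne_zero {a : ZMod 2} (h : a ≠ 0) : a = 1 := by
  revert h; revert a; decide

/-- A combination of packets orthogonal to `x` is again orthogonal to `x`, so a hit cannot arise at
a node that has not been hit. -/
theorem Hit.active {x : Fin k → ZMod 2} {c : Code k L} {s : Traffic L} {i n : ℕ}
    (h : Hit x c s i n) : Active x c s i n := by
  cases i with
  | zero => trivial
  | succ i =>
    have hL : i + 1 < L := by
      by_contra hL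
      have := h.2
      simp [bit, hL] at this
    have h1 := h.2
    rw [bit_succ hL] at h1
    obtain ⟨m, hm, hne⟩ := Finset.exists_ne_zero_of_sum_ne_zero (h1 ▸ one_ne_zero)
    have hs : success s i m = true := by
      by_contra hs
      simp [hs] at hne
    refine ⟨m, Finset.mem_range.1 hm, hs, zmod_two_eq_one_of_ne_zero fun h0 => ?_⟩
    simp [h0] at hne

theorem Active.mono {x : Fin k → ZMod 2} {c : Code k L} {s : Traffic L} {i m n : ℕ}
    (h : Active x c s i m) (hmn : m ≤ n) : Active x c s i n := by
  cases i with
  | zero => trivial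
  | succ i =>
    obtain ⟨l, hl, hh⟩ := h
    exact ⟨l, hl.trans_le hmn, hh⟩

theorem isFront_zero_succ {x : Fin k → ZMod 2} {c : Code k L} {s : Traffic L} {n : ℕ}
    (h : IsFront x c s 0 (n + 1)) : IsFront x c s 0 n ∧ ¬ Hit x c s 0 n :=
  ⟨⟨trivial, fun h' => h.2 (h'.mono n.le_succ)⟩, fun h' => h.2 ⟨n, n.lt_succ_self, h'⟩⟩

/-- The front moves by at most one node per slot: a first hit received in slot `n` came from a node
already active before slot `n`, since nodes combine only packets from strictly earlier slots. -/
theorem isFront_succ_succ {x : Fin k → ZMod 2} {c : Code k L} {s : Traffic L} {i n : ℕ}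
    (h : IsFront x c s (i + 1) (n + 1)) :
    (IsFront x c s (i + 1) n ∧ ¬ Hit x c s (i + 1) n) ∨ (IsFront x c s i n ∧ Hit x c s i n) := by
  by_cases ha : Active x c s (i + 1) n
  · exact Or.inl ⟨⟨ha, fun h' => h.2 (h'.mono n.le_succ)⟩, fun h' => h.2 ⟨n, n.lt_succ_self, h'⟩⟩
  · obtain ⟨m, hm, hh⟩ := h.1
    obtain rfl : m = n := by
      by_contra hne
      exact ha ⟨m, by omega, hh⟩
    exact Or.inr ⟨⟨hh.active, ha⟩, hh⟩

theorem exists_isFront {x : Fin k → ZMod 2} {c : Code k L} {s : Traffic L} {n : ℕ} :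
    ∀ {l : ℕ}, ¬ Active x c s l n → ∃ i < l, IsFront x c s i n
  | 0, h => absurd trivial h
  | l + 1, h => by
    by_cases hl : Active x c s l n
    · exact ⟨l, l.lt_succ_self, hl, h⟩
    · obtain ⟨i, hi, hf⟩ := exists_isFront hl
      exact ⟨i, hi.trans l.lt_succ_self, hf⟩

/-! ### Measurability. -/

theorem measurable_coeff (J : CoeffIndex k L) : Measurable fun c : Code k L => c J :=
  measurable_pi_apply J

theorem measurable_success (i t : ℕ) : Measurable fun s : Traffic L => success s i t := by
  unfold success
  split_ifs with h
  · exact measurable_pi_apply _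
  · exact measurable_const

theorem measurable_bit (x : Fin k → ZMod 2) (i t : ℕ) :
    Measurable fun q : Code k L × Traffic L => bit x q.1 q.2 i t := by
  induction i generalizing t with
  | zero =>
    by_cases hL : 0 < L
    · simp only [bit_zero hL]
      exact Finset.measurable_sum _ fun a _ =>
        (((measurable_coeff (Sum.inl (t, a))).comp measurable_fst).const_mul _)
    · simp [bit, hL]
  | succ i ih =>
    by_cases hL : i + 1 < L
    · simp only [bit_succ hL]
      refine Finset.measurable_sum _ fun m _ => Measurable.ite ?_ ?_ measurable_const
      · exact ((measurable_success i m).comp measurable_snd) (measurableSet_singleton true)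
      · exact (measurable_of_countable fun a : ZMod 2 × ZMod 2 => a.1 * a.2).comp
          (((measurable_coeff (Sum.inr (⟨i + 1, hL⟩, t, m))).comp measurable_fst).prodMk (ih m))
    · simp [bit, hL]

theorem measurableSet_hit (x : Fin k → ZMod 2) (i t : ℕ) :
    MeasurableSet {q : Code k L × Traffic L | Hit x q.1 q.2 i t} :=
  (((measurable_success i t).comp measurable_snd) (measurableSet_singleton true)).inter
    (measurable_bit x i t (measurableSet_singleton 1))

theorem measurableSet_active (x : Fin k → ZMod 2) (i n : ℕ) :
    MeasurableSet {q : Code k L × Traffic L | Active x q.1 q.2 i n} := by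
  cases i with
  | zero => simp [Active]
  | succ i =>
    have : {q : Code k L × Traffic L | Active x q.1 q.2 (i + 1) n} =
        ⋃ m ∈ Finset.range n, {q : Code k L × Traffic L | Hit x q.1 q.2 i m} := by
      ext q
      simp [Active]
    rw [this]
    exact Finset.measurableSet_biUnion _ fun m _ => measurableSet_hit x i m

theorem measurableSet_isFront (x : Fin k → ZMod 2) (i n : ℕ) :
    MeasurableSet {q : Code k L × Traffic L | IsFront x q.1 q.2 i n} :=
  (measurableSet_active x i n).inter (measurableSet_active x (i + 1) n).compl

theorem measurable_bit_left (x : Fin k → ZMod 2) (s : Traffic L) (i t : ℕ) :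
    Measurable fun c : Code k L => bit x c s i t :=
  (measurable_bit x i t).comp measurable_prodMk_right

theorem measurableSet_isFront_left (x : Fin k → ZMod 2) (s : Traffic L) (i n : ℕ) :
    MeasurableSet {c : Code k L | IsFront x c s i n} :=
  measurable_prodMk_right (measurableSet_isFront x i n)

theorem measurableSet_hit_left (x : Fin k → ZMod 2) (s : Traffic L) (i n : ℕ) :
    MeasurableSet {c : Code k L | Hit x c s i n} :=
  measurable_prodMk_right (measurableSet_hit x i n)

/-! ### Conditional uniformity of the bit at the front. -/

theorem bit_zero_update (hL : 0 < L) {x : Fin k → ZMod 2} {a : Fin k} (ha : x a = 1)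
    (c : Code k L) (s : Traffic L) (n : ℕ) (v : ZMod 2) :
    bit x (Function.update c (Sum.inl (n, a)) v) s 0 n =
      bit x (Function.update c (Sum.inl (n, a)) 0) s 0 n + v := by
  have hv : v = ∑ a', if a' = a then v else 0 := by simp
  conv_rhs => rw [hv]
  rw [bit_zero hL, bit_zero hL, ← Finset.sum_add_distrib]
  refine Finset.sum_congr rfl fun a' _ => ?_
  by_cases h : a' = a
  · subst h
    simp [ha]
  · simp [h]

theorem bit_succ_update {i : ℕ} (h : i + 1 < L) {x : Fin k → ZMod 2} {c : Code k L}
    {s : Traffic L} {m n : ℕ} (hm : m < n) (hh : Hit x c s i m) (v : ZMod 2) :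
    bit x (Function.update c (Sum.inr (⟨i + 1, h⟩, n, m)) v) s (i + 1) n =
      bit x (Function.update c (Sum.inr (⟨i + 1, h⟩, n, m)) 0) s (i + 1) n + v := by
  have hv : v = ∑ m' ∈ Finset.range n, if m' = m then v else 0 := by simp [hm]
  conv_rhs => rw [hv]
  rw [bit_succ h, bit_succ h, ← Finset.sum_add_distrib]
  refine Finset.sum_congr rfl fun m' hm' => ?_
  have hs : m' < slot (Sum.inr (⟨i + 1, h⟩, n, m) : CoeffIndex k L) := Finset.mem_range.1 hm'
  rw [bit_update x c s hs, bit_update x c s hs]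
  by_cases h' : m' = m
  · subst h'
    simp [hh.1, hh.2]
  · simp [h']

/-- The bit sent by an active node is uniform given the past. -/
theorem codeLaw_isFront_bit {x : Fin k → ZMod 2} (hx : x ≠ 0) (s : Traffic L) {i : ℕ}
    (hi : i < L) (n : ℕ) (β : ZMod 2) :
    codeLaw k L ({c | IsFront x c s i n} ∩ {c | bit x c s i n = β}) =
      2⁻¹ * codeLaw k L {c | IsFront x c s i n} := by
  cases i with
  | zero =>
    obtain ⟨a, ha⟩ := Function.ne_iff.1 hx
    refine codeLaw_inter_bit (measurableSet_isFront_left x s 0 n) (measurable_bit_left x s 0 n)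
      (Sum.inl (n, a)) (fun c v => ?_) (fun c _ v => ?_) β
    · exact isFront_update x c s (by simp [slot]) v 0
    · exact bit_zero_update hi (zmod_two_eq_one_of_ne_zero ha) c s n v
  | succ i =>
    classical
    -- Split by the slot `m` of the first hit received by node `i + 1`. On `A m`, the coefficient
    -- given to that packet in slot `n` shifts the bit, while `A m` is decided by slots before `n`.
    let A : ℕ → Set (Code k L) := fun m =>
      {c | IsFront x c s (i + 1) n} ∩ ({c | Hit x c s i m} ∩ ⋂ m' ∈ Finset.range m,
        {c | Hit x c s i m'}ᶜ)
    have hAm : ∀ m, MeasurableSet (A m) := fun m =>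
      (measurableSet_isFront_left x s _ n).inter ((measurableSet_hit_left x s i m).inter
        (Finset.measurableSet_biInter _ fun m' _ => (measurableSet_hit_left x s i m').compl))
    have hU : {c | IsFront x c s (i + 1) n} = ⋃ m ∈ Finset.range n, A m := by
      ext c
      simp only [Set.mem_iUnion, exists_prop]
      constructor
      · intro hc
        have hex : ∃ m, m < n ∧ Hit x c s i m := hc.1
        refine ⟨Nat.find hex, Finset.mem_range.2 (Nat.find_spec hex).1, hc,
          (Nat.find_spec hex).2, ?_⟩
        simp only [Set.mem_iInter]
        intro m' hm' hh
        have hlt := Finset.mem_range.1 hm'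
        exact Nat.find_min hex hlt ⟨hlt.trans (Nat.find_spec hex).1, hh⟩
      · rintro ⟨m, -, hc⟩
        exact hc.1
    have hd : ∀ m m', m < m' → Disjoint (A m) (A m') := by
      intro m m' hlt
      rw [Set.disjoint_left]
      intro c hc hc'
      have := Set.mem_iInter₂.1 hc'.2.2 m (Finset.mem_range.2 hlt)
      exact this hc.2.1
    have hd' : (↑(Finset.range n) : Set ℕ).PairwiseDisjoint A := by
      intro m _ m' _ hne
      rcases lt_or_gt_of_ne hne with h | h
      · exact hd m m' h
      · exact (hd m' m h).symm
    have key : ∀ m ∈ Finset.range n,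
        codeLaw k L (A m ∩ {c | bit x c s (i + 1) n = β}) = 2⁻¹ * codeLaw k L (A m) := by
      intro m hm
      have hm := Finset.mem_range.1 hm
      refine codeLaw_inter_bit (hAm m) (measurable_bit_left x s _ n)
        (Sum.inr (⟨i + 1, hi⟩, n, m)) (fun c v => ?_) (fun c hc v => ?_) β
      · have h1 : ∀ m' < n, Hit x (Function.update c (Sum.inr (⟨i + 1, hi⟩, n, m)) v) s i m' ↔
            Hit x c s i m' := fun m' hm' => hit_update x c s hm' v i
        have h2 : IsFront x (Function.update c (Sum.inr (⟨i + 1, hi⟩, n, m)) v) s (i + 1) n ↔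
            IsFront x c s (i + 1) n := isFront_update x c s le_rfl v (i + 1)
        simp only [A, Set.mem_inter_iff, Set.mem_iInter, Set.mem_compl_iff, Set.mem_ofPred_eq]
        refine and_congr h2 (and_congr (h1 m hm) (forall₂_congr fun m' hm' => not_congr ?_))
        exact h1 m' ((Finset.mem_range.1 hm').trans hm)
      · exact bit_succ_update hi hm hc.2.1 v
    have hβ : MeasurableSet {c : Code k L | bit x c s (i + 1) n = β} :=
      measurable_bit_left x s _ n (measurableSet_singleton β)
    rw [hU, Set.iUnion₂_inter, measure_biUnion_finset hd' fun m _ => hAm m,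
      measure_biUnion_finset (hd'.mono fun m => Set.inter_subset_left) fun m _ =>
        (hAm m).inter hβ, Finset.mul_sum]
    exact Finset.sum_congr rfl key

/-! ### Law of the front for a fixed traffic, and the union bound. -/

/-- Over a given traffic, the law of the front: in each successful slot it advances with
probability one half. -/
noncomputable def frontWeight (s : Traffic L) : ℕ → ℕ → ℝ≥0∞
  | 0, i => if i = 0 then 1 else 0
  | n + 1, 0 => (if success s 0 n = true then 2⁻¹ else 1) * frontWeight s n 0
  | n + 1, i + 1 => (if success s (i + 1) n = true then 2⁻¹ else 1) * frontWeight s n (i + 1) +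
      (if success s i n = true then 2⁻¹ else 0) * frontWeight s n i

theorem codeLaw_isFront_not_hit_le {x : Fin k → ZMod 2} (hx : x ≠ 0) (s : Traffic L) {i : ℕ}
    (hi : i < L) (n : ℕ) :
    codeLaw k L {c | IsFront x c s i n ∧ ¬ Hit x c s i n} ≤
      (if success s i n = true then 2⁻¹ else 1) * codeLaw k L {c | IsFront x c s i n} := by
  split_ifs with h
  · rw [← codeLaw_isFront_bit hx s hi n 0]
    refine measure_mono fun c hc => ⟨hc.1, ?_⟩
    by_contra h0
    exact hc.2 ⟨h, zmod_two_eq_one_of_ne_zero h0⟩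
  · rw [one_mul]
    exact measure_mono fun c hc => hc.1

theorem codeLaw_isFront_hit_le {x : Fin k → ZMod 2} (hx : x ≠ 0) (s : Traffic L) {i : ℕ}
    (hi : i < L) (n : ℕ) :
    codeLaw k L {c | IsFront x c s i n ∧ Hit x c s i n} ≤
      (if success s i n = true then 2⁻¹ else 0) * codeLaw k L {c | IsFront x c s i n} := by
  split_ifs with h
  · rw [← codeLaw_isFront_bit hx s hi n 1]
    exact measure_mono fun c hc => ⟨hc.1, hc.2.2⟩
  · have : {c : Code k L | IsFront x c s i n ∧ Hit x c s i n} = ∅ :=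
      Set.eq_empty_of_forall_notMem fun c hc => h hc.2.1
    simp [this]

/-- Induction on the slot: the front either stayed without a hit or arrived by a hit from the
preceding node, and both bounds follow from the uniform bit. -/
theorem codeLaw_isFront_le {x : Fin k → ZMod 2} (hx : x ≠ 0) (s : Traffic L) (n : ℕ) {i : ℕ}
    (hi : i < L) : codeLaw k L {c | IsFront x c s i n} ≤ frontWeight s n i := by
  induction n generalizing i with
  | zero =>
    cases i with
    | zero => simpa [frontWeight] using prob_le_one
    | succ i => simp [IsFront, Active]
  | succ n ih =>
    cases i with
    | zero =>
      calc codeLaw k L {c | IsFront x c s 0 (n + 1)}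
          ≤ codeLaw k L {c | IsFront x c s 0 n ∧ ¬ Hit x c s 0 n} :=
            measure_mono fun c hc => isFront_zero_succ hc
        _ ≤ _ := (codeLaw_isFront_not_hit_le hx s hi n).trans (mul_le_mul_right (ih hi) _)
    | succ i =>
      have hi' : i < L := Nat.lt_of_succ_lt hi
      calc codeLaw k L {c | IsFront x c s (i + 1) (n + 1)}
          ≤ codeLaw k L ({c | IsFront x c s (i + 1) n ∧ ¬ Hit x c s (i + 1) n} ∪
              {c | IsFront x c s i n ∧ Hit x c s i n}) :=
            measure_mono fun c hc => isFront_succ_succ hc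
        _ ≤ codeLaw k L {c | IsFront x c s (i + 1) n ∧ ¬ Hit x c s (i + 1) n} +
              codeLaw k L {c | IsFront x c s i n ∧ Hit x c s i n} := measure_union_le _ _
        _ ≤ _ := add_le_add
            ((codeLaw_isFront_not_hit_le hx s hi n).trans (mul_le_mul_right (ih hi) _))
            ((codeLaw_isFront_hit_le hx s hi' n).trans (mul_le_mul_right (ih hi') _))

/-- A code that does not allow decoding leaves some nonzero functional undetected at the sink. -/
theorem exists_not_active_of_not_decodable (hL : 1 ≤ L) {c : Code k L} {s : Traffic L} {n : ℕ}
    (h : ¬ Decodable c s n) : ∃ x : Fin k → ZMod 2, x ≠ 0 ∧ ¬ Active x c s L n := by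
  have hspan : Submodule.span (ZMod 2) (sinkReceived c s n) ≠ ⊤ := by
    intro htop
    obtain ⟨b, hbs, hbspan, hli⟩ := exists_linearIndependent (ZMod 2) (sinkReceived c s n)
    rw [htop] at hbspan
    have hbas : Module.Basis b (ZMod 2) (Fin k → ZMod 2) :=
      Module.Basis.mk hli (by simp [hbspan])
    have e : b ≃ Fin k := hbas.indexEquiv (Pi.basisFun (ZMod 2) (Fin k))
    exact h ⟨fun a => (e.symm a : Fin k → ZMod 2), fun a => hbs (e.symm a).2,
      hli.comp _ e.symm.injective⟩
  obtain ⟨f, hf, hle⟩ := Submodule.exists_le_ker_of_lt_top _ (lt_top_iff_ne_top.2 hspan)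
  have hfx : ∀ y, f y = (fun a => f (Pi.single a 1)) ⬝ᵥ y := by
    intro y
    conv_lhs => rw [pi_eq_sum_univ' y]
    rw [map_sum]
    refine Finset.sum_congr rfl fun a _ => ?_
    rw [map_smul, smul_eq_mul, mul_comm]
  refine ⟨fun a => f (Pi.single a 1), fun h0 => hf ?_, ?_⟩
  · refine LinearMap.ext fun y => ?_
    rw [hfx, h0, zero_dotProduct, LinearMap.zero_apply]
  · obtain ⟨l, rfl⟩ : ∃ l, L = l + 1 := ⟨L - 1, by omega⟩
    rintro ⟨m, hm, hs, hb⟩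
    have hl : l < l + 1 := l.lt_succ_self
    simp only [success, hl, dif_pos] at hs
    simp only [bit, hl, dif_pos, ← hfx] at hb
    have : packet c s l hl m ∈ sinkReceived c s n := ⟨l, hl, m, rfl, hm, hs, rfl⟩
    have h0 : f (packet c s l hl m) = 0 := hle (Submodule.subset_span this)
    rw [h0] at hb
    exact zero_ne_one hb

theorem codeLaw_exists_isFront_le (s : Traffic L) (n : ℕ) :
    codeLaw k L {c | ∃ x : Fin k → ZMod 2, x ≠ 0 ∧ ∃ i < L, IsFront x c s i n} ≤
      2 ^ k * ∑ i ∈ Finset.range L, frontWeight s n i := by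
  calc codeLaw k L {c | ∃ x : Fin k → ZMod 2, x ≠ 0 ∧ ∃ i < L, IsFront x c s i n}
      ≤ codeLaw k L (⋃ x ∈ (Finset.univ.filter fun x : Fin k → ZMod 2 => x ≠ 0),
          ⋃ i ∈ Finset.range L, {c | IsFront x c s i n}) := by
        refine measure_mono fun c hc => ?_
        obtain ⟨x, hx, i, hi, hf⟩ := hc
        simp only [Set.mem_iUnion]
        exact ⟨x, by simpa using hx, i, Finset.mem_range.2 hi, hf⟩
    _ ≤ ∑ x ∈ (Finset.univ.filter fun x : Fin k → ZMod 2 => x ≠ 0),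
          ∑ i ∈ Finset.range L, frontWeight s n i := by
        refine (measure_biUnion_finset_le _ _).trans (Finset.sum_le_sum fun x hx => ?_)
        refine (measure_biUnion_finset_le _ _).trans (Finset.sum_le_sum fun i hi => ?_)
        exact codeLaw_isFront_le (by simpa using hx) s n (Finset.mem_range.1 hi)
    _ ≤ 2 ^ k * ∑ i ∈ Finset.range L, frontWeight s n i := by
        rw [Finset.sum_const, nsmul_eq_mul]
        gcongr
        have : (Finset.univ.filter fun x : Fin k → ZMod 2 => x ≠ 0).card ≤ 2 ^ k := by
          refine (Finset.card_le_univ _).trans ?_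
          simp [ZMod.card]
        exact_mod_cast this

/-! ### Fractional moments over the traffic. -/

theorem frontWeight_update (s : Traffic L) {J : Fin L × ℕ} {n : ℕ} (hJ : n ≤ J.2) (b : Bool)
    (i : ℕ) : frontWeight (Function.update s J b) n i = frontWeight s n i := by
  induction n generalizing i with
  | zero => cases i <;> rfl
  | succ n ih =>
    have hs : ∀ i, success (Function.update s J b) i n = success s i n := by
      intro i
      unfold success
      split_ifs with h
      · have hne : ((⟨i, h⟩ : Fin L), n) ≠ J := by
          rintro rfl
          exact absurd hJ (by simp)
        rw [Function.update_of_ne hne]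
      · rfl
    have hn : n ≤ J.2 := Nat.le_of_succ_le hJ
    cases i <;> simp only [frontWeight, hs, ih hn]

theorem measurable_frontWeight (n i : ℕ) :
    Measurable fun s : Traffic L => frontWeight s n i := by
  have hm : ∀ i n (a b : ℝ≥0∞),
      Measurable fun s : Traffic L => if success s i n = true then a else b := fun i n a b =>
    Measurable.ite (measurable_success i n (measurableSet_singleton true)) measurable_const
      measurable_const
  induction n generalizing i with
  | zero => cases i <;> simp [frontWeight]
  | succ n ih =>
    cases i with
    | zero => exact (hm 0 n _ _).mul (ih 0)
    | succ i => exact ((hm (i + 1) n _ _).mul (ih (i + 1))).add ((hm i n _ _).mul (ih i))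

/-- A function of the traffic that does not involve the transmission `J` is independent of its
success. -/
theorem lintegral_trafficLaw_mul_ite (p : Fin L → unitInterval) {F : Traffic L → ℝ≥0∞}
    (hF : Measurable F) (J : Fin L × ℕ) (hFJ : ∀ s b, F (Function.update s J b) = F s)
    (a b : ℝ≥0∞) :
    ∫⁻ s, (if s J = true then a else b) * F s ∂(trafficLaw p) =
      (a * ENNReal.ofReal (p J.1) + b * ENNReal.ofReal (1 - p J.1)) *
        ∫⁻ s, F s ∂(trafficLaw p) := by
  have hm : Measurable fun s : Traffic L => (if s J = true then a else b) * F s :=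
    (Measurable.ite (measurable_pi_apply J (measurableSet_singleton true)) measurable_const
      measurable_const).mul hF
  rw [trafficLaw, lintegral_infinitePi_update _ J hm, ← lintegral_const_mul _ hF]
  refine lintegral_congr fun s => ?_
  simp only [hFJ, Function.update_self]
  rw [lintegral_mul_const _ (measurable_of_countable _), bernoulliMeasure_def]
  congr 1
  rw [lintegral_add_measure, lintegral_smul_measure, lintegral_smul_measure, lintegral_dirac,
    lintegral_dirac]
  have h1 : ∀ x : unitInterval, (unitInterval.toNNReal x : ℝ≥0∞) = ENNReal.ofReal (x : ℝ) :=
    fun x => (ENNReal.ofReal_coe_nnreal (p := unitInterval.toNNReal x)).symm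
  rw [ENNReal.smul_def, ENNReal.smul_def, h1, h1, unitInterval.coe_symm_eq]
  simp [mul_comm]

/-- Fractional moments of the law of the front. -/
noncomputable def frontMoment (p : Fin L → unitInterval) (α : ℝ) (n i : ℕ) : ℝ≥0∞ :=
  ∫⁻ s, frontWeight s n i ^ α ∂(trafficLaw p)

/-- Success probabilities, with node indices of type `ℕ`. -/
noncomputable def successProb (p : Fin L → unitInterval) (i : ℕ) : ℝ≥0∞ :=
  if h : i < L then ENNReal.ofReal (p ⟨i, h⟩) else 0

/-- Loss probabilities, with node indices of type `ℕ`. -/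
noncomputable def lossProb (p : Fin L → unitInterval) (i : ℕ) : ℝ≥0∞ :=
  if h : i < L then ENNReal.ofReal (1 - p ⟨i, h⟩) else 1

theorem lintegral_success_mul_frontWeight (p : Fin L → unitInterval) {α : ℝ} (n i : ℕ)
    (a b : ℝ≥0∞) (j : ℕ) :
    ∫⁻ s, (if success s i n = true then a else b) * frontWeight s n j ^ α ∂(trafficLaw p) =
      (a * successProb p i + b * lossProb p i) * frontMoment p α n j := by
  by_cases h : i < L
  · simp only [success, successProb, lossProb, h, dif_pos, frontMoment]
    exact lintegral_trafficLaw_mul_ite p ((measurable_frontWeight n j).pow_const α)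
      ((⟨i, h⟩ : Fin L), n) (fun s b => by rw [frontWeight_update s le_rfl]) a b
  -- Beyond the last link nothing succeeds, in agreement with the default probabilities 0 and 1.
  · simp only [success, successProb, lossProb, h, dif_neg, not_false_eq_true, Bool.false_eq_true,
      if_false, mul_zero, zero_add, mul_one, frontMoment]
    exact lintegral_const_mul _ ((measurable_frontWeight n j).pow_const α)

theorem frontMoment_succ_zero_le (p : Fin L → unitInterval) {α : ℝ} (hα : 0 < α) (n : ℕ) :
    frontMoment p α (n + 1) 0 ≤
      (2⁻¹ ^ α * successProb p 0 + lossProb p 0) * frontMoment p α n 0 := by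
  have h := lintegral_success_mul_frontWeight p (α := α) n 0 (2⁻¹ ^ α) 1 0
  rw [one_mul] at h
  rw [← h, frontMoment]
  refine lintegral_mono fun s => ?_
  simp only [frontWeight]
  rw [ENNReal.mul_rpow_of_nonneg _ _ hα.le]
  split_ifs <;> simp

/-- Subadditivity of the power `α ≤ 1` separates staying from arriving; the success in slot `n` is
independent of `frontWeight s n`. -/
theorem frontMoment_succ_succ_le (p : Fin L → unitInterval) {α : ℝ} (hα : 0 < α) (hα1 : α ≤ 1)
    (n i : ℕ) :
    frontMoment p α (n + 1) (i + 1) ≤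
      (2⁻¹ ^ α * successProb p (i + 1) + lossProb p (i + 1)) * frontMoment p α n (i + 1) +
        2⁻¹ ^ α * successProb p i * frontMoment p α n i := by
  have h := lintegral_success_mul_frontWeight p (α := α) n (i + 1) (2⁻¹ ^ α) 1 (i + 1)
  have h' := lintegral_success_mul_frontWeight p (α := α) n i (2⁻¹ ^ α) 0 i
  rw [one_mul] at h
  rw [zero_mul, add_zero] at h'
  have hm : Measurable fun s : Traffic L =>
      (if success s (i + 1) n = true then (2⁻¹ : ℝ≥0∞) ^ α else 1) *
        frontWeight s n (i + 1) ^ α :=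
    (Measurable.ite (measurable_success _ n (measurableSet_singleton true)) measurable_const
      measurable_const).mul ((measurable_frontWeight n _).pow_const α)
  rw [← h, ← h', frontMoment, ← lintegral_add_left hm]
  refine lintegral_mono fun s => ?_
  simp only [frontWeight]
  refine (ENNReal.rpow_add_le_add_rpow _ _ hα.le hα1).trans ?_
  rw [ENNReal.mul_rpow_of_nonneg _ _ hα.le, ENNReal.mul_rpow_of_nonneg _ _ hα.le]
  refine add_le_add ?_ ?_
  · split_ifs <;> simp
  · split_ifs <;> simp [hα]

/-- The weight `z ^ i` charges a factor `z` for every advance, so a sum over all positions obeys a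
scalar recursion in which advancing is almost free for small `z`. -/
theorem sum_frontMoment_le (hL : 1 ≤ L) (p : Fin L → unitInterval) {α : ℝ} (hα : 0 < α)
    (hα1 : α ≤ 1) {z β : ℝ≥0∞}
    (hβ : ∀ i < L, 2⁻¹ ^ α * successProb p i + lossProb p i +
      z * (2⁻¹ ^ α * successProb p i) ≤ β) (n : ℕ) :
    ∑ i ∈ Finset.range L, z ^ i * frontMoment p α n i ≤ β ^ n := by
  obtain ⟨l, rfl⟩ : ∃ l, L = l + 1 := ⟨L - 1, by omega⟩
  induction n with
  | zero =>
    rw [Finset.sum_range_succ']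
    simp [frontMoment, frontWeight, hα]
  | succ n ih =>
    let X : ℕ → ℝ≥0∞ := fun i =>
      z ^ i * ((2⁻¹ ^ α * successProb p i + lossProb p i) * frontMoment p α n i)
    let Y : ℕ → ℝ≥0∞ := fun i =>
      z ^ (i + 1) * (2⁻¹ ^ α * successProb p i * frontMoment p α n i)
    calc ∑ i ∈ Finset.range (l + 1), z ^ i * frontMoment p α (n + 1) i
        ≤ ∑ i ∈ Finset.range l, (X (i + 1) + Y i) + X 0 := by
          rw [Finset.sum_range_succ']
          refine add_le_add (Finset.sum_le_sum fun i _ => ?_) ?_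
          · simp only [X, Y, ← mul_add]
            exact mul_le_mul_right (frontMoment_succ_succ_le p hα hα1 n i) _
          · exact mul_le_mul_right (frontMoment_succ_zero_le p hα n) _
      _ = ∑ i ∈ Finset.range (l + 1), X i + ∑ i ∈ Finset.range l, Y i := by
          rw [Finset.sum_range_succ', Finset.sum_add_distrib]
          ring
      -- Adding the departure over the last link completes each position to a full factor at most
      -- `β`.
      _ ≤ ∑ i ∈ Finset.range (l + 1), X i + ∑ i ∈ Finset.range (l + 1), Y i := by
          gcongr
          exact Nat.le_succ l
      _ = ∑ i ∈ Finset.range (l + 1), (2⁻¹ ^ α * successProb p i + lossProb p i +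
            z * (2⁻¹ ^ α * successProb p i)) * (z ^ i * frontMoment p α n i) := by
          rw [← Finset.sum_add_distrib]
          refine Finset.sum_congr rfl fun i _ => ?_
          simp only [X, Y]
          ring
      _ ≤ ∑ i ∈ Finset.range (l + 1), β * (z ^ i * frontMoment p α n i) :=
          Finset.sum_le_sum fun i hi => mul_le_mul_left (hβ i (Finset.mem_range.1 hi)) _
      _ ≤ β ^ (n + 1) := by
          rw [← Finset.mul_sum, pow_succ']
          exact mul_le_mul_right ih _

theorem rpow_sum_le_sum_rpow {ι : Type*} (t : Finset ι) (f : ι → ℝ≥0∞) {α : ℝ} (hα : 0 < α)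
    (hα1 : α ≤ 1) : (∑ i ∈ t, f i) ^ α ≤ ∑ i ∈ t, f i ^ α := by
  classical
  induction t using Finset.induction_on with
  | empty => simp [hα]
  | insert a t ha ih =>
    rw [Finset.sum_insert ha, Finset.sum_insert ha]
    exact (ENNReal.rpow_add_le_add_rpow _ _ hα.le hα1).trans (add_le_add le_rfl ih)

theorem lintegral_sum_frontWeight_rpow_le (hL : 1 ≤ L) (p : Fin L → unitInterval) {α : ℝ}
    (hα : 0 < α) (hα1 : α ≤ 1) {z β : ℝ≥0∞} (hz : z ≠ 0) (hz1 : z ≤ 1)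
    (hβ : ∀ i < L, 2⁻¹ ^ α * successProb p i + lossProb p i +
      z * (2⁻¹ ^ α * successProb p i) ≤ β) (n : ℕ) :
    ∫⁻ s, (∑ i ∈ Finset.range L, frontWeight s n i) ^ α ∂(trafficLaw p) ≤
      z⁻¹ ^ L * β ^ n := by
  have hzt : z ≠ ∞ := ne_top_of_le_ne_top ENNReal.one_ne_top hz1
  calc ∫⁻ s, (∑ i ∈ Finset.range L, frontWeight s n i) ^ α ∂(trafficLaw p)
      ≤ ∫⁻ s, ∑ i ∈ Finset.range L, frontWeight s n i ^ α ∂(trafficLaw p) :=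
        lintegral_mono fun s => rpow_sum_le_sum_rpow _ _ hα hα1
    _ = ∑ i ∈ Finset.range L, frontMoment p α n i :=
        lintegral_finsetSum _ fun i _ => (measurable_frontWeight n i).pow_const α
    _ ≤ ∑ i ∈ Finset.range L, z⁻¹ ^ L * (z ^ i * frontMoment p α n i) := by
        refine Finset.sum_le_sum fun i hi => ?_
        have h1 : z⁻¹ ^ i * z ^ i = 1 := by
          rw [← mul_pow, ENNReal.inv_mul_cancel hz hzt, one_pow]
        have h2 : 1 ≤ z⁻¹ := ENNReal.one_le_inv.2 hz1
        calc frontMoment p α n i = z⁻¹ ^ i * (z ^ i * frontMoment p α n i) := by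
              rw [← mul_assoc, h1, one_mul]
          _ ≤ _ := mul_le_mul_left (pow_le_pow_right₀ h2 (Finset.mem_range.1 hi).le) _
    _ ≤ z⁻¹ ^ L * β ^ n := by
        rw [← Finset.mul_sum]
        exact mul_le_mul_right (sum_frontMoment_le hL p hα hα1 hβ n) _

/-! ### From failure probabilities to the average coding delay. -/

/-- The pairs of a code and a traffic for which some nonzero functional is not yet detected at the
sink before slot `n`. -/
def undetected (k L n : ℕ) : Set (Code k L × Traffic L) :=
  {q | ∃ x : Fin k → ZMod 2, x ≠ 0 ∧ ∃ i < L, IsFront x q.1 q.2 i n}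

theorem measurableSet_undetected (n : ℕ) : MeasurableSet (undetected k L n) := by
  have : undetected k L n = ⋃ x ∈ (Finset.univ.filter fun x : Fin k → ZMod 2 => x ≠ 0),
      ⋃ i ∈ Finset.range L, {q : Code k L × Traffic L | IsFront x q.1 q.2 i n} := by
    ext q
    simp [undetected]
  rw [this]
  exact Finset.measurableSet_biUnion _ fun x _ =>
    Finset.measurableSet_biUnion _ fun i _ => measurableSet_isFront x i n

/-- Every slot count before the first detection of all functionals contributes 1 to the sum, and
decoding is possible at that first time. -/
theorem codingDelay_le_tsum (hL : 1 ≤ L) (c : Code k L) (s : Traffic L) :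
    codingDelay c s ≤ ∑' n, (undetected k L n).indicator 1 (c, s) := by
  classical
  by_cases h : ∃ n, (c, s) ∉ undetected k L n
  · have hdec : Decodable c s (Nat.find h) := by
      by_contra hd
      obtain ⟨x, hx, ha⟩ := exists_not_active_of_not_decodable hL hd
      exact Nat.find_spec h ⟨x, hx, exists_isFront ha⟩
    calc codingDelay c s ≤ (Nat.find h : ℝ≥0∞) := iInf₂_le _ hdec
      _ = ∑ n ∈ Finset.range (Nat.find h), (undetected k L n).indicator 1 (c, s) := by
          rw [Finset.sum_congr rfl (g := fun _ => (1 : ℝ≥0∞))]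
          · simp
          · intro n hn
            have hmem : (c, s) ∈ undetected k L n := not_not.1 (Nat.find_min h (Finset.mem_range.1 hn))
            simp [hmem]
      _ ≤ _ := ENNReal.sum_le_tsum _
  · push Not at h
    have : ∀ n, (undetected k L n).indicator (1 : Code k L × Traffic L → ℝ≥0∞) (c, s) = 1 :=
      fun n => by simp [h n]
    simp [this]

/-- The union bound on the conditional failure probability before slot `n`, relative to a level
`e`, truncated and raised to the power `α`. -/
noncomputable def failureBound (k : ℕ) (e : ℝ≥0∞) (α : ℝ) (n : ℕ) (s : Traffic L) : ℝ≥0∞ :=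
  min 1 ((2 ^ k * (∑ i ∈ Finset.range L, frontWeight s n i) / e) ^ α)

theorem measurable_failureBound (e : ℝ≥0∞) (α : ℝ) (n : ℕ) :
    Measurable (failureBound (L := L) k e α n) :=
  measurable_const.min ((((Finset.measurable_sum _ fun i _ =>
    measurable_frontWeight n i).const_mul _).div_const _).pow_const _)

/-- The average coding delay exceeds its typical bound with small probability over the code. -/
theorem codeLaw_lt_averageCodingDelay_le_of_tsum (hL : 1 ≤ L) (p : Fin L → unitInterval)
    {e : ℝ≥0∞} (he : e ≠ 0) (he' : e ≠ ∞) {α : ℝ} (hα : 0 < α) (hα1 : α ≤ 1) {S H : ℝ≥0∞}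
    (hS : ∑' n, ∫⁻ s, failureBound k e α n s ∂(trafficLaw p) ≤ S) (hH : H ≠ 0) (hH' : H ≠ ∞) :
    codeLaw k L {c | S + H < averageCodingDelay p c} ≤ e * S / H := by
  let G : ℕ → Traffic L → ℝ≥0∞ := fun n s => 2 ^ k * ∑ i ∈ Finset.range L, frontWeight s n i
  have hG : ∀ n, Measurable (G n) := fun n =>
    (Finset.measurable_sum _ fun i _ => measurable_frontWeight n i).const_mul _
  have hgood : ∀ n, MeasurableSet {s | G n s ≤ e} := fun n => measurableSet_le (hG n) measurable_const
  -- Failures for which the union bound `G n` is at most `e`; only these are averaged over the code.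
  let D : ℕ → Set (Code k L × Traffic L) := fun n => undetected k L n ∩ {q | G n q.2 ≤ e}
  have hD : ∀ n, MeasurableSet (D n) := fun n =>
    (measurableSet_undetected n).inter (measurable_snd (hgood n))
  have hDm : ∀ n, Measurable ((D n).indicator (1 : Code k L × Traffic L → ℝ≥0∞)) := fun n =>
    measurable_one.indicator (hD n)
  let A : Code k L → ℝ≥0∞ := fun c => ∫⁻ s, ∑' n, (D n).indicator 1 (c, s) ∂(trafficLaw p)
  have hT : Measurable fun q : Code k L × Traffic L =>
      ∑' n, (D n).indicator (1 : Code k L × Traffic L → ℝ≥0∞) q := Measurable.tsum hDm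
  have hA : Measurable A := hT.lintegral_prod_right'
  have hm : ∀ n, Measurable fun s : Traffic L => failureBound k e α n s :=
    measurable_failureBound e α
  have havg : ∀ c, averageCodingDelay p c ≤ A c + S := by
    intro c
    calc averageCodingDelay p c
        ≤ ∫⁻ s, (∑' n, (D n).indicator 1 (c, s) + ∑' n, failureBound k e α n s)
            ∂(trafficLaw p) := by
          refine lintegral_mono fun s => (codingDelay_le_tsum hL c s).trans ?_
          rw [← ENNReal.tsum_add]
          refine ENNReal.tsum_le_tsum fun n => ?_
          by_cases h1 : (c, s) ∈ undetected k L n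
          · by_cases h2 : G n s ≤ e
            · have h3 : (c, s) ∈ D n := ⟨h1, h2⟩
              simp [h1, h3]
            -- When the union bound exceeds `e`, `failureBound` equals 1 and absorbs the failure for
            -- every code.
            · have h3 : (1 : ℝ≥0∞) ≤ failureBound k e α n s := by
                refine le_min le_rfl (ENNReal.one_le_rpow ?_ hα)
                rw [ENNReal.le_div_iff_mul_le (Or.inl he) (Or.inl he'), one_mul]
                exact (not_le.1 h2).le
              simpa [h1] using h3.trans le_add_self
          · simp [h1]
      _ = A c + ∑' n, ∫⁻ s, failureBound k e α n s ∂(trafficLaw p) := by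
          rw [lintegral_add_right _ (Measurable.tsum hm),
            lintegral_tsum fun n => (hm n).aemeasurable]
      _ ≤ A c + S := by gcongr
  have hAint : ∫⁻ c, A c ∂(codeLaw k L) ≤ e * S := by
    calc ∫⁻ c, A c ∂(codeLaw k L)
        = ∫⁻ s, ∫⁻ c, ∑' n, (D n).indicator 1 (c, s) ∂(codeLaw k L) ∂(trafficLaw p) :=
          lintegral_lintegral_swap hT.aemeasurable
      _ ≤ ∫⁻ s, ∑' n, e * failureBound k e α n s ∂(trafficLaw p) := by
          refine lintegral_mono fun s => ?_
          have hDs : ∀ n, Measurable fun c : Code k L =>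
              (D n).indicator (1 : Code k L × Traffic L → ℝ≥0∞) (c, s) := fun n =>
            (hDm n).comp measurable_prodMk_right
          rw [lintegral_tsum fun n => (hDs n).aemeasurable]
          refine ENNReal.tsum_le_tsum fun n => ?_
          by_cases h2 : G n s ≤ e
          · have h3 : ∫⁻ c, (D n).indicator 1 (c, s) ∂(codeLaw k L) ≤ G n s := by
              refine le_trans ?_ (codeLaw_exists_isFront_le s n)
              have h4 : MeasurableSet {c | (c, s) ∈ undetected k L n} :=
                measurable_prodMk_right (measurableSet_undetected n)
              refine le_trans (lintegral_mono fun c => ?_) (lintegral_indicator_one h4).le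
              by_cases h5 : (c, s) ∈ undetected k L n
              · have h6 : (c, s) ∈ D n := ⟨h5, h2⟩
                simp [h5, h6]
              · have h6 : (c, s) ∉ D n := fun h => h5 h.1
                simp [h6]
            have h7 : G n s / e ≤ 1 := by
              rw [ENNReal.div_le_iff he he', one_mul]
              exact h2
            -- A number in `[0, 1]` only grows under the power `α ≤ 1`, so the same function also
            -- controls the good slots.
            have h8 : G n s / e ≤ failureBound k e α n s := by
              refine le_min h7 ?_
              calc G n s / e = (G n s / e) ^ (1 : ℝ) := (ENNReal.rpow_one _).symm
                _ ≤ (G n s / e) ^ α := ENNReal.rpow_le_rpow_of_exponent_ge h7 hα1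
            calc _ ≤ G n s := h3
              _ = e * (G n s / e) := (ENNReal.mul_div_cancel he he').symm
              _ ≤ _ := mul_le_mul_right h8 _
          · have h3 : ∀ c, (D n).indicator (1 : Code k L × Traffic L → ℝ≥0∞) (c, s) = 0 :=
              fun c => Set.indicator_of_notMem (fun h => h2 h.2) _
            simp [h3]
      _ = e * ∑' n, ∫⁻ s, failureBound k e α n s ∂(trafficLaw p) := by
          rw [lintegral_tsum fun n => ((hm n).const_mul e).aemeasurable, ← ENNReal.tsum_mul_left]
          exact tsum_congr fun n => lintegral_const_mul _ (hm n)
      _ ≤ e * S := by gcongr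
  calc codeLaw k L {c | S + H < averageCodingDelay p c}
      ≤ codeLaw k L {c | H ≤ A c} := by
        refine measure_mono fun c hc => ?_
        by_contra hlt
        have hlt : A c < H := not_le.1 hlt
        have hc : S + H < averageCodingDelay p c := hc
        refine absurd (hc.trans_le (havg c)) (not_lt.2 ?_)
        rw [add_comm]
        gcongr
    _ ≤ (∫⁻ c, A c ∂(codeLaw k L)) / H := meas_ge_le_lintegral_div hA.aemeasurable hH hH'
    _ ≤ e * S / H := ENNReal.div_le_div_right hAint _

/-! ### Summation over slots and the quantitative bound. -/

theorem tsum_le_of_le_geometric {f : ℕ → ℝ≥0∞} {C β : ℝ≥0∞} {n₀ : ℕ} (h1 : ∀ n, f n ≤ 1)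
    (h2 : ∀ n, f n ≤ C * β ^ n) (hn₀ : C * β ^ n₀ ≤ 1) : ∑' n, f n ≤ n₀ + (1 - β)⁻¹ := by
  rw [← Summable.sum_add_tsum_nat_add' (k := n₀) (f := f) ENNReal.summable]
  refine add_le_add ?_ ?_
  · refine (Finset.sum_le_sum fun n _ => h1 n).trans ?_
    simp
  · rw [← ENNReal.tsum_geometric]
    refine ENNReal.tsum_le_tsum fun n => (h2 _).trans ?_
    calc C * β ^ (n + n₀) = C * β ^ n₀ * β ^ n := by rw [pow_add]; ring
      _ ≤ 1 * β ^ n := mul_le_mul_left hn₀ _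
      _ = β ^ n := one_mul _

theorem tsum_lintegral_failureBound_le (hL : 1 ≤ L) (p : Fin L → unitInterval)
    {e : ℝ≥0∞} {α : ℝ} (hα : 0 < α) (hα1 : α ≤ 1) {z β : ℝ≥0∞} (hz : z ≠ 0) (hz1 : z ≤ 1)
    (hβ : ∀ i < L, 2⁻¹ ^ α * successProb p i + lossProb p i +
      z * (2⁻¹ ^ α * successProb p i) ≤ β) {n₀ : ℕ}
    (hn₀ : (2 ^ k / e) ^ α * z⁻¹ ^ L * β ^ n₀ ≤ 1) :
    ∑' n, ∫⁻ s, failureBound k e α n s ∂(trafficLaw p) ≤ n₀ + (1 - β)⁻¹ := by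
  have h1 : ∀ n, ∫⁻ s, failureBound k e α n s ∂(trafficLaw p) ≤ 1 := by
    intro n
    calc ∫⁻ s, failureBound k e α n s ∂(trafficLaw p)
        ≤ ∫⁻ _, 1 ∂(trafficLaw p) := lintegral_mono fun s => min_le_left _ _
      _ = 1 := by rw [lintegral_one, measure_univ]
  have h2 : ∀ n, ∫⁻ s, failureBound k e α n s ∂(trafficLaw p) ≤
      (2 ^ k / e) ^ α * z⁻¹ ^ L * β ^ n := by
    intro n
    calc ∫⁻ s, failureBound k e α n s ∂(trafficLaw p)
        ≤ ∫⁻ s, (2 ^ k / e) ^ α * (∑ i ∈ Finset.range L, frontWeight s n i) ^ α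
            ∂(trafficLaw p) := by
          refine lintegral_mono fun s => ?_
          rw [← ENNReal.mul_rpow_of_nonneg _ _ hα.le, ← ENNReal.mul_div_right_comm]
          exact min_le_right _ _
      _ = (2 ^ k / e) ^ α * ∫⁻ s, (∑ i ∈ Finset.range L, frontWeight s n i) ^ α
            ∂(trafficLaw p) :=
          lintegral_const_mul _ ((Finset.measurable_sum _ fun i _ =>
            measurable_frontWeight n i).pow_const _)
      _ ≤ (2 ^ k / e) ^ α * (z⁻¹ ^ L * β ^ n) :=
          mul_le_mul_right (lintegral_sum_frontWeight_rpow_le hL p hα hα1 hz hz1 hβ n) _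
      _ = (2 ^ k / e) ^ α * z⁻¹ ^ L * β ^ n := by rw [mul_assoc]
  exact tsum_le_of_le_geometric h1 h2 hn₀

theorem inv_two_rpow_div_log_two (t : ℝ) :
    (2⁻¹ : ℝ≥0∞) ^ (t / Real.log 2) = ENNReal.ofReal (Real.exp (-t)) := by
  have h2 : (2⁻¹ : ℝ≥0∞) = ENNReal.ofReal 2⁻¹ := by
    rw [ENNReal.ofReal_inv_of_pos two_pos]
    simp
  have hlog : Real.log 2 ≠ 0 := (Real.log_pos one_lt_two).ne'
  rw [h2, ENNReal.ofReal_rpow_of_pos (by norm_num), Real.rpow_def_of_pos (by norm_num),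
    Real.log_inv]
  congr 2
  field_simp

/-- A quantitative form of the main theorem, with free parameters `t` and `X`. -/
theorem codeLaw_lt_averageCodingDelay_le (hk : 1 ≤ k) (hL : 1 ≤ L) (p : Fin L → unitInterval)
    {P : ℝ} (hP0 : 0 < P) (hP : ∀ i, P ≤ p i) {e : ℝ} (he : 0 < e) {t κ X : ℝ} (ht : 0 < t)
    (ht1 : t ≤ Real.log 2) (hκ : 0 < κ) (hκt : κ ≤ 1 - Real.exp (-t) * (1 + 1 / k)) (hX0 : 0 ≤ X)
    (hX : t * (k + Real.logb 2 (1 / e)) + L * Real.log k ≤ κ * X) :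
    codeLaw k L {c | ENNReal.ofReal ((X + 2 + 1 / κ) / P) < averageCodingDelay p c} ≤
      ENNReal.ofReal (e * (X + 1 + 1 / κ)) := by
  have hk0 : (0 : ℝ) < k := by exact_mod_cast hk
  have hlog2 : 0 < Real.log 2 := Real.log_pos one_lt_two
  have hP1 : P ≤ 1 := (hP ⟨0, hL⟩).trans (p ⟨0, hL⟩).2.2
  have hκ1 : κ ≤ 1 := hκt.trans (by
    have : 0 ≤ Real.exp (-t) * (1 + 1 / k) := by positivity
    linarith)
  have hPκ : 0 < P * κ := mul_pos hP0 hκ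
  have hPκ1 : P * κ ≤ 1 := mul_le_one₀ hP1 hκ.le hκ1
  -- Chosen so that `2⁻¹ ^ α = exp (-t)`.
  set α : ℝ := t / Real.log 2 with hαdef
  have hα : 0 < α := div_pos ht hlog2
  have hα1 : α ≤ 1 := (div_le_one hlog2).2 ht1
  -- From this slot on the geometric bound is below 1. Rounding up costs at most `1 ≤ 1 / P`; with
  -- `1 / (P * κ)` for the tail and `H = 1 / P` this gives `(X + 2 + 1 / κ) / P`.
  set n₀ : ℕ := ⌈X / P⌉₊ with hn₀def
  have hn₀ : X ≤ P * n₀ := by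
    have := Nat.le_ceil (X / P)
    rw [div_le_iff₀ hP0] at this
    linarith
  have hn₀' : (n₀ : ℝ) ≤ (X + 1) / P := by
    have h1 := (Nat.ceil_lt_add_one (div_nonneg hX0 hP0.le)).le
    have h2 : 1 ≤ 1 / P := (one_le_div hP0).2 hP1
    rw [add_div]
    linarith
  have hz : (ENNReal.ofReal (k : ℝ)⁻¹)⁻¹ = ENNReal.ofReal (k : ℝ) := by
    rw [ENNReal.ofReal_inv_of_pos hk0, inv_inv]
  -- With `z = 1 / k` the factor of link `i` is `1 - p i * (1 - exp (-t) * (1 + 1 / k))`, largest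
  -- where `p i` is smallest.
  have hβ : ∀ i < L, 2⁻¹ ^ α * successProb p i + lossProb p i +
      ENNReal.ofReal (k : ℝ)⁻¹ * (2⁻¹ ^ α * successProb p i) ≤ ENNReal.ofReal (1 - P * κ) := by
    intro i hi
    have hp0 : (0 : ℝ) ≤ p ⟨i, hi⟩ := (p ⟨i, hi⟩).2.1
    have hp1 : (p ⟨i, hi⟩ : ℝ) ≤ 1 := (p ⟨i, hi⟩).2.2
    have hPi := hP ⟨i, hi⟩
    simp only [successProb, lossProb, hi, dif_pos]
    generalize (p ⟨i, hi⟩ : ℝ) = y at hp0 hp1 hPi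
    rw [hαdef, inv_two_rpow_div_log_two, ← ENNReal.ofReal_mul (Real.exp_pos _).le,
      ← ENNReal.ofReal_mul (by positivity), ← ENNReal.ofReal_add (by positivity) (by linarith),
      ← ENNReal.ofReal_add (by linarith [mul_nonneg (Real.exp_pos (-t)).le hp0]) (by positivity)]
    refine ENNReal.ofReal_le_ofReal ?_
    have h1 : y * κ ≤ y * (1 - Real.exp (-t) * (1 + 1 / k)) := mul_le_mul_of_nonneg_left hκt hp0
    have h2 : P * κ ≤ y * κ := mul_le_mul_of_nonneg_right hPi hκ.le
    rw [one_div] at h1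
    linarith
  have hC : (2 ^ k / ENNReal.ofReal e) ^ α * (ENNReal.ofReal (k : ℝ)⁻¹)⁻¹ ^ L *
      ENNReal.ofReal (1 - P * κ) ^ n₀ ≤ 1 := by
    have h2k : (2 : ℝ≥0∞) ^ k / ENNReal.ofReal e = ENNReal.ofReal (2 ^ k / e) := by
      rw [ENNReal.ofReal_div_of_pos he, ENNReal.ofReal_pow two_pos.le]
      simp
    have hpos : (0 : ℝ) < 2 ^ k / e := by positivity
    rw [h2k, hz, ENNReal.ofReal_rpow_of_pos hpos, ← ENNReal.ofReal_pow hk0.le,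
      ← ENNReal.ofReal_pow (by linarith), ← ENNReal.ofReal_mul (by positivity),
      ← ENNReal.ofReal_mul (by positivity), ENNReal.ofReal_le_one]
    have h1 : (2 ^ k / e : ℝ) ^ α = Real.exp (t * (k + Real.logb 2 (1 / e))) := by
      rw [Real.rpow_def_of_pos hpos, Real.log_div (by positivity) he.ne', Real.log_pow, Real.logb,
        one_div, Real.log_inv, hαdef]
      congr 1
      field_simp
      ring
    have h3 : (k : ℝ) ^ L = Real.exp (L * Real.log k) := by
      rw [← Real.log_pow, Real.exp_log (by positivity)]
    have h4 : (1 - P * κ) ^ n₀ ≤ Real.exp (-(P * n₀ * κ)) := by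
      calc (1 - P * κ) ^ n₀ ≤ Real.exp (-(P * κ)) ^ n₀ :=
            pow_le_pow_left₀ (by linarith) (Real.one_sub_le_exp_neg _) _
        _ = _ := by
            rw [← Real.exp_nat_mul]
            congr 1
            ring
    rw [h1, h3]
    calc Real.exp (t * (k + Real.logb 2 (1 / e))) * Real.exp (L * Real.log k) * (1 - P * κ) ^ n₀
        ≤ Real.exp (t * (k + Real.logb 2 (1 / e))) * Real.exp (L * Real.log k) *
            Real.exp (-(P * n₀ * κ)) := by gcongr
      _ = Real.exp (t * (k + Real.logb 2 (1 / e)) + L * Real.log k + -(P * n₀ * κ)) := by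
          rw [Real.exp_add, Real.exp_add]
      _ ≤ 1 := by
          rw [Real.exp_le_one_iff]
          have := mul_le_mul_of_nonneg_left hn₀ hκ.le
          linarith
  have hsum := tsum_lintegral_failureBound_le hL p hα hα1
    (ENNReal.ofReal_pos.2 (inv_pos.2 hk0)).ne' (by
      rw [ENNReal.ofReal_le_one]
      exact inv_le_one_of_one_le₀ (by exact_mod_cast hk)) hβ hC
  have hS : (n₀ : ℝ≥0∞) + (1 - ENNReal.ofReal (1 - P * κ))⁻¹ =
      ENNReal.ofReal (n₀ + 1 / (P * κ)) := by
    rw [ENNReal.ofReal_add (by positivity) (by positivity), ENNReal.ofReal_natCast,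
      ← ENNReal.ofReal_one, ← ENNReal.ofReal_sub _ (by linarith), one_div,
      ENNReal.ofReal_inv_of_pos hPκ, sub_sub_cancel]
  rw [hS] at hsum
  have hmain := codeLaw_lt_averageCodingDelay_le_of_tsum hL p (ENNReal.ofReal_pos.2 he).ne'
    ENNReal.ofReal_ne_top hα hα1 hsum (ENNReal.ofReal_pos.2 (one_div_pos.2 hP0)).ne'
    ENNReal.ofReal_ne_top
  have hn₀S : n₀ + 1 / (P * κ) ≤ (X + 1 + 1 / κ) / P := by
    have : 1 / (P * κ) = 1 / κ / P := by
      field_simp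
    rw [this, add_div _ (1 / κ)]
    linarith
  refine le_trans (measure_mono fun c hc => ?_) (hmain.trans ?_)
  · refine lt_of_le_of_lt ?_ (Set.mem_ofPred_eq ▸ hc)
    rw [← ENNReal.ofReal_add (by positivity) (by positivity)]
    refine ENNReal.ofReal_le_ofReal ?_
    calc n₀ + 1 / (P * κ) + 1 / P ≤ (X + 1 + 1 / κ) / P + 1 / P := by gcongr
      _ = _ := by ring
  · rw [← ENNReal.ofReal_mul he.le, ← ENNReal.ofReal_div_of_pos (one_div_pos.2 hP0)]
    refine ENNReal.ofReal_le_ofReal ?_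
    calc e * (n₀ + 1 / (P * κ)) / (1 / P) ≤ e * ((X + 1 + 1 / κ) / P) / (1 / P) := by gcongr
      _ = _ := by field_simp

/-! ### Choice of the parameters. -/

/-- The main theorem for a fixed `k`, in terms of `t = √(L log(kL/ε) / k)`. -/
theorem codeLaw_lt_averageCodingDelay_le_of_small (hk : 1 ≤ k) (hL : 1 ≤ L)
    (p : Fin L → unitInterval) {P : ℝ} (hP0 : 0 < P) (hP : ∀ i, P ≤ p i) {ε : ℝ} (hε : 0 < ε)
    (hε1 : ε < 1) {t Λ : ℝ} (hΛ : Λ = Real.logb 2 (k * L / ε)) (hΛ1 : 1000 ≤ Λ) (ht : 0 < t)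
    (ht1 : t ≤ 1 / 100) (htΛ : k * t ^ 2 = L * Λ) {Y : ℝ} (hY : k + 7 / 5 * (k * t) ≤ Y) :
    codeLaw k L {c | ENNReal.ofReal (1 / P * Y) < averageCodingDelay p c} ≤
      ENNReal.ofReal ε := by
  have hk0 : (0 : ℝ) < k := by exact_mod_cast hk
  have hL1 : (1 : ℝ) ≤ L := by exact_mod_cast hL
  have hlog2 : 0 < Real.log 2 := Real.log_pos one_lt_two
  have hLΛ : Λ ≤ k * t ^ 2 := by
    rw [htΛ]
    nlinarith
  have hkt2 : 1000 ≤ k * t ^ 2 := hΛ1.trans hLΛ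
  have hkt : 100000 ≤ k * t := by nlinarith [mul_pos hk0 ht]
  have hkk : 1000 ≤ (k : ℝ) := by nlinarith
  set κ : ℝ := 1 - Real.exp (-t) * (1 + 1 / k) with hκdef
  have hexp : Real.exp (-t) ≤ 1 - t + t ^ 2 / 2 := by
    rw [Real.exp_neg]
    have h1 := Real.quadratic_le_exp_of_nonneg ht.le
    rw [inv_le_iff_one_le_mul₀ (Real.exp_pos t)]
    calc 1 ≤ (1 - t + t ^ 2 / 2) * (1 + t + t ^ 2 / 2) := by nlinarith [sq_nonneg (t ^ 2)]
      _ ≤ (1 - t + t ^ 2 / 2) * Real.exp t :=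
        mul_le_mul_of_nonneg_left h1 (by nlinarith)
  have hexp1 : Real.exp (-t) ≤ 1 := Real.exp_le_one_iff.2 (by linarith)
  have hkinv : 1 / (k : ℝ) ≤ t ^ 2 / 10 := by
    rw [div_le_iff₀ hk0]
    nlinarith
  -- Here `3/5 = 1/2 + 1/10`, from the quadratic term of the exponential and from `1 / k`.
  have hκ : t * (1 - 3 / 5 * t) ≤ κ := by
    have : Real.exp (-t) * (1 / k) ≤ 1 / k :=
      mul_le_of_le_one_left (by positivity) hexp1
    rw [hκdef, mul_add, mul_one]
    nlinarith
  have hκt : t / 2 ≤ κ := by nlinarith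
  have hκ0 : 0 < κ := by linarith
  have hκinv : 1 / κ ≤ k * t / 100 := by
    rw [div_le_iff₀ hκ0]
    nlinarith [mul_le_mul_of_nonneg_left hκt (mul_pos hk0 ht).le]
  -- The constant `7/10` bounds `ln 2`, the change from base 2 to the natural logarithm.
  have hlogk : Real.log k ≤ 7 / 10 * Λ := by
    have h1 : Real.logb 2 k ≤ Λ := by
      rw [hΛ]
      refine Real.logb_le_logb_of_le one_lt_two hk0 ?_
      rw [le_div_iff₀ hε]
      nlinarith
    rw [Real.logb, div_le_iff₀ hlog2] at h1
    nlinarith [Real.log_two_lt_d9]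
  have hlogk' : L * Real.log k ≤ 7 / 10 * (k * t ^ 2) := by
    rw [htΛ]
    nlinarith
  have hlogε : Real.logb 2 (1 / (ε / (4 * k))) ≤ 2 * (k * t ^ 2) := by
    have h1 : Real.logb 2 (1 / (ε / (4 * k))) ≤ Real.logb 2 (4 * (k * L / ε)) := by
      refine Real.logb_le_logb_of_le one_lt_two (by positivity) ?_
      rw [one_div_div, mul_div_assoc]
      gcongr
      exact le_mul_of_one_le_right hk0.le hL1
    have h4 : Real.logb 2 4 = 2 := by
      rw [show (4 : ℝ) = 2 ^ (2 : ℝ) by norm_num, Real.logb_rpow two_pos (by norm_num)]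
    rw [Real.logb_mul (by norm_num) (by positivity), ← hΛ, h4] at h1
    linarith
  -- Since `27/20` exceeds `3/5 + 7/10` by `1/20`, the excess absorbs the terms of higher order in
  -- `t ≤ 1/100`. The level `e = ε / (4 * k)` works because `X + 1 + 1 / κ ≤ 4 * k`.
  have hX : t * (k + Real.logb 2 (1 / (ε / (4 * k)))) + L * Real.log k ≤
      κ * (k + 27 / 20 * (k * t)) := by
    have h1 : t * (1 - 3 / 5 * t) * (k + 27 / 20 * (k * t)) ≤ κ * (k + 27 / 20 * (k * t)) :=
      mul_le_mul_of_nonneg_right hκ (by positivity)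
    have h2 := mul_le_mul_of_nonneg_left hlogε ht.le
    have h3 : k * t ^ 2 * t ≤ k * t ^ 2 * (1 / 100) := mul_le_mul_of_nonneg_left ht1 (by positivity)
    nlinarith
  have hktk : k * t ≤ k * (1 / 100) := mul_le_mul_of_nonneg_left ht1 hk0.le
  refine le_trans (measure_mono fun c hc => ?_) ((codeLaw_lt_averageCodingDelay_le hk hL p hP0 hP
    (e := ε / (4 * k)) (by positivity) ht (by linarith [Real.log_two_gt_d9]) hκ0 le_rfl
    (by positivity) hX).trans ?_)
  · refine lt_of_le_of_lt (ENNReal.ofReal_le_ofReal ?_) (Set.mem_ofPred_eq ▸ hc)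
    rw [div_eq_mul_inv, mul_comm, ← one_div]
    refine mul_le_mul_of_nonneg_left ?_ (by positivity)
    linarith
  · refine ENNReal.ofReal_le_ofReal ?_
    rw [div_mul_eq_mul_div, div_le_iff₀ (by positivity)]
    refine mul_le_mul_of_nonneg_left ?_ hε.le
    linarith

/-! ### Asymptotic comparison with the stated overhead. -/

/-- The logarithmic factor of the overhead is at least almost half of `log (k L / ε)`. -/
theorem logb_le_logb_window {k L ε w : ℝ} (hk : 1 ≤ k) (hL : 1 ≤ L) (hε : 0 < ε) (hε1 : ε < 1)
    (hΛ : 0 < Real.logb 2 (k * L / ε))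
    (hw : 99 / 100 * (k * L / Real.logb 2 (k * L / ε)) ^ (1 / 2 : ℝ) ≤ w)
    (hlog : Real.logb 2 (Real.logb 2 (k * L / ε)) + 1 ≤ 1 / 25 * Real.logb 2 (k * L / ε)) :
    12 / 25 * Real.logb 2 (k * L / ε) ≤ Real.logb 2 (w * L / ε) := by
  have hk0 : 0 < k := by linarith
  have hL0 : 0 < L := by linarith
  -- The total loss from `Λ / 2` is then at most `(log Λ + 1) / 2 ≤ Λ / 50`, and `1/2 - 1/50 =
  -- 12/25`.
  have h99 : -(1 / 2 : ℝ) ≤ Real.logb 2 (99 / 100) := by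
    rw [Real.le_logb_iff_rpow_le one_lt_two (by norm_num), Real.rpow_neg two_pos.le,
      ← Real.sqrt_eq_rpow]
    rw [inv_le_iff_one_le_mul₀ (by positivity)]
    have : (1.4 : ℝ) ≤ √2 := Real.le_sqrt_of_sq_le (by norm_num)
    linarith
  have hΛeq : Real.logb 2 (k * L / ε) = Real.logb 2 (k * L) - Real.logb 2 ε :=
    Real.logb_div (by positivity) hε.ne'
  have hLlog : 0 ≤ Real.logb 2 L := Real.logb_nonneg one_lt_two hL
  have hεlog : Real.logb 2 ε ≤ 0 := Real.logb_nonpos one_lt_two hε.le hε1.le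
  set Λ := Real.logb 2 (k * L / ε) with hΛdef
  have hmono : Real.logb 2 (99 / 100 * (k * L / Λ) ^ (1 / 2 : ℝ) * L / ε) ≤
      Real.logb 2 (w * L / ε) := by
    refine Real.logb_le_logb_of_le one_lt_two (by positivity) ?_
    gcongr
  have hexpand : Real.logb 2 (99 / 100 * (k * L / Λ) ^ (1 / 2 : ℝ) * L / ε) =
      Real.logb 2 (99 / 100) + 1 / 2 * (Real.logb 2 (k * L) - Real.logb 2 Λ) + Real.logb 2 L -
        Real.logb 2 ε := by
    rw [Real.logb_div (by positivity) hε.ne', Real.logb_mul (by positivity) hL0.ne',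
      Real.logb_mul (by norm_num) (by positivity), Real.logb_rpow_eq_mul_logb_of_pos (by positivity),
      Real.logb_div (by positivity) hΛ.ne']
  linarith

theorem tendsto_logb_two_atTop : Tendsto (Real.logb 2) atTop atTop :=
  Real.tendsto_logb_atTop one_lt_two

theorem eventually_logb_le : ∀ᶠ x : ℝ in atTop, Real.logb 2 x + 1 ≤ 1 / 25 * x := by
  have h1 : ∀ᶠ x : ℝ in atTop, ‖Real.log x‖ ≤ 1 / 100 * ‖x‖ :=
    Real.isLittleO_log_id_atTop.def (by norm_num)
  filter_upwards [h1, eventually_ge_atTop 100] with x hx hx1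
  rw [Real.norm_of_nonneg (by linarith : (0 : ℝ) ≤ x)] at hx
  have h2 : Real.log x ≤ 1 / 100 * x := (le_abs_self _).trans hx
  have hlog2 : 1 / 2 ≤ Real.log 2 := by linarith [Real.log_two_gt_d9]
  have h3 : Real.logb 2 x ≤ 1 / 50 * x := by
    rw [Real.logb, div_le_iff₀ (by linarith)]
    nlinarith
  linarith

end LineNetwork

theorem mainTheorem2
    (L : ℕ → ℕ) (hL : ∀ k, 1 ≤ L k)
    (p : (k : ℕ) → Fin (L k) → unitInterval) (hp : ∀ k i, 0 < p k i)
    (ε : ℕ → ℝ) (hε : ∀ k, 0 < ε k ∧ ε k < 1)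
    (w : ℕ → ℝ)
    (hw : w ~[atTop] fun k : ℕ =>
      ((k : ℝ) * L k / Real.logb 2 ((k : ℝ) * L k / ε k)) ^ (1 / 2 : ℝ))
    (hwk : (fun k : ℕ => w k * Real.logb 2 (w k * L k / ε k)) =o[atTop] fun k : ℕ => (k : ℝ)) :
    ∃ δ : ℕ → ℝ, Tendsto δ atTop (𝓝 0) ∧
      ∀ᶠ k : ℕ in atTop,
        LineNetwork.codeLaw k (L k)
          {c | ENNReal.ofReal (1 / (⨅ i, (p k i : ℝ)) *
                ((k : ℝ) + (1 + δ k) *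
                  ((k : ℝ) * L k / w k + w k * Real.logb 2 (w k * L k / ε k)))) <
              LineNetwork.averageCodingDelay (p k) c}
          ≤ ENNReal.ofReal (ε k) := by
  -- No correction is needed: the stated overhead exceeds the proved one by a constant factor.
  refine ⟨fun _ => 0, tendsto_const_nhds, ?_⟩
  have hΛtop : Tendsto (fun k : ℕ => Real.logb 2 ((k : ℝ) * L k / ε k)) atTop atTop := by
    refine tendsto_atTop_mono' _ ?_
      (LineNetwork.tendsto_logb_two_atTop.comp tendsto_natCast_atTop_atTop)
    filter_upwards [eventually_ge_atTop 1] with k hk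
    have hk0 : (0 : ℝ) < k := by exact_mod_cast hk
    have hL1 : (1 : ℝ) ≤ L k := by exact_mod_cast hL k
    refine Real.logb_le_logb_of_le one_lt_two hk0 ?_
    rw [le_div_iff₀ (hε k).1]
    nlinarith [(hε k).2]
  filter_upwards [eventually_ge_atTop 1, hΛtop.eventually_ge_atTop 1000,
    hΛtop.eventually LineNetwork.eventually_logb_le,
    hw.isLittleO.def (c := 1 / 100) (by norm_num),
    hwk.def (c := 1 / 250) (by norm_num)] with k hk hΛ1 hΛlog hwW hwo
  have hk0 : (0 : ℝ) < k := by exact_mod_cast hk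
  have hL1 : (1 : ℝ) ≤ L k := by exact_mod_cast hL k
  have hL0 : (0 : ℝ) < L k := by linarith
  obtain ⟨hε0, hε1⟩ := hε k
  have hlogw := LineNetwork.logb_le_logb_window (w := w k) (k := k) (L := L k)
    (by exact_mod_cast hk) hL1 hε0 hε1
  set Λ : ℝ := Real.logb 2 ((k : ℝ) * L k / ε k) with hΛ
  have hΛ0 : 0 < Λ := by linarith
  set W : ℝ := ((k : ℝ) * L k / Λ) ^ (1 / 2 : ℝ) with hW
  have hW0 : 0 < W := by positivity
  have hWsq : W ^ 2 = k * L k / Λ := by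
    rw [hW, ← Real.sqrt_eq_rpow, Real.sq_sqrt (by positivity)]
  rw [Pi.sub_apply, Real.norm_of_nonneg hW0.le, Real.norm_eq_abs, abs_le] at hwW
  have hw1 : 99 / 100 * W ≤ w k := by linarith
  have hw2 : w k ≤ 101 / 100 * W := by linarith
  have hw0 : 0 < w k := by linarith
  replace hlogw := hlogw hΛ0 hw1 hΛlog
  -- This is `√(L Λ / k)`; both `k * L / W` and `W * Λ` equal `k * t`.
  obtain ⟨t, ht⟩ : ∃ t, t = W * Λ / k := ⟨_, rfl⟩
  have ht0 : 0 < t := by rw [ht]; positivity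
  have hkt : k * t = W * Λ := by rw [ht]; field_simp
  have htΛ : k * t ^ 2 = L k * Λ := by
    rw [ht, div_pow, mul_pow, hWsq]
    field_simp
  have hkL : (k : ℝ) * L k = W * (W * Λ) := by
    rw [← mul_assoc, ← sq, hWsq]
    field_simp
  have hO2 : 99 / 100 * (12 / 25) * (k * t) ≤ w k * Real.logb 2 (w k * L k / ε k) := by
    calc 99 / 100 * (12 / 25) * (k * t) = 99 / 100 * W * (12 / 25 * Λ) := by rw [hkt]; ring
      _ ≤ _ := mul_le_mul hw1 hlogw (by positivity) hw0.le
  have hO1 : 99 / 100 * (k * t) ≤ k * L k / w k := by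
    rw [le_div_iff₀ hw0, hkL, hkt]
    have := mul_le_mul_of_nonneg_left hw2 (mul_pos hW0 hΛ0).le
    nlinarith [mul_pos hW0 (mul_pos hW0 hΛ0)]
  -- The only use of `w log (wL/ε) = o(k)`: with `hO2` it gives `0.4752 * k * t ≤ k / 250`.
  have ht1 : t ≤ 1 / 100 := by
    rw [Real.norm_of_nonneg hk0.le] at hwo
    have h1 := (le_abs_self _).trans hwo
    have h2 : k * t ≤ k * (1 / 100) := by linarith
    exact le_of_mul_le_mul_left h2 hk0
  have : Nonempty (Fin (L k)) := ⟨⟨0, hL k⟩⟩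
  obtain ⟨i₀, hi₀⟩ := exists_eq_ciInf_of_finite (f := fun i => (p k i : ℝ))
  have hP0 : 0 < ⨅ i, (p k i : ℝ) := by
    rw [← hi₀]
    exact hp k i₀
  refine LineNetwork.codeLaw_lt_averageCodingDelay_le_of_small hk (hL k) (p k) hP0
    (fun i => ciInf_le (Set.finite_range _).bddBelow i) hε0 hε1 hΛ hΛ1 ht0 ht1 htΛ ?_
  -- `hO1` and `hO2` add up to `0.99 * (1 + 12/25) > 7/5` times `k * t`.
  rw [add_zero, one_mul]
  linarith [mul_pos hk0 ht0]
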